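/- Let $d\ge 1$, $0<q<\infty$, and let $\mu$ be a positive Borel measure on $\mathbb{C}^d$, where $|z|$ denotes the Euclidean norm of $z\in\mathbb{C}^d$. The measure $\mu$ is called $q$-Carleson for a linear space $X$ of entire functions on $\mathbb{C}^d$ if $X\subset L^q(\mathbb{C}^d,\mu)$. For $\beta\in\mathbb{R}$, let $\mathcal{F}^\infty_{1,\beta}(\mathbb{C}^d)$ be the space of all entire functions $f$ on $\mathbb{C}^d$ with $$\sup_{z\in\mathbb{C}^d} \frac{|f(z)|}{(1+|z|)^{\beta}\, e^{|z|^2/2}}<\infty,$$ and for $\alpha>0$, let $\mathcal{F}^\infty_{\alpha}(\mathbb{C}^d)$ be the space of all entire functions $f$ on $\mathbb{C}^d$ with $$\sup_{z\in\mathbb{C}^d} |f(z)|\,e^{-\frac{\alpha}{2}|z|^2}<\infty.$$ Then: 1. For every $\beta\in\mathbb{R}$, $\mu$ is $q$-Carleson for $\mathcal{F}^\infty_{1,\beta}(\mathbb{C}^d)$ if and only if $$\int_{\mathbb{C}^d} (1+|z|)^{\beta q}\, e^{\frac{q}{2}|z|^2}\,d\mu(z)<\infty.$$ 2. For every $\alpha>0$,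 $\mu$ is $q$-Carleson for $\mathcal{F}^\infty_{\alpha}(\mathbb{C}^d)$ if and only if $$\int_{\mathbb{C}^d} e^{\frac{\alpha q}{2}|z|^2}\,d\mu(z)<\infty.$$ -/

import Mathlib

open MeasureTheory

namespace FockCarleson

/-- The space `ℂ^d` with its Euclidean norm (and its Borel sigma-algebra). -/
abbrev Cd (d : ℕ) : Type := EuclideanSpace ℂ (Fin d)

/-- The growth space of a radial weight `w`: the entire functions `f` on `ℂ^d` for which
`sup_z |f z| / w(|z|)` is finite. -/
def growthSpace (d : ℕ) (w : ℝ → ℝ) : Submodule ℂ (Cd d → ℂ) where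
  carrier := {f | Differentiable ℂ f ∧ BddAbove (Set.range fun z : Cd d => ‖f z‖ / w ‖z‖)}
  zero_mem' := by
    refine ⟨differentiable_const 0, 0, ?_⟩
    rintro _ ⟨z, rfl⟩
    simp
  add_mem' := by
    rintro f g ⟨hf, A, hA⟩ ⟨hg, B, hB⟩
    refine ⟨hf.add hg, |A| + |B|, ?_⟩
    rintro _ ⟨z, rfl⟩
    have h1 : ‖f z‖ / w ‖z‖ ≤ A := hA ⟨z, rfl⟩
    have h2 : ‖g z‖ / w ‖z‖ ≤ B := hB ⟨z, rfl⟩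
    rcases le_total 0 (w ‖z‖) with hw | hw
    · have h3 : ‖f z + g z‖ / w ‖z‖ ≤ (‖f z‖ + ‖g z‖) / w ‖z‖ :=
        div_le_div_of_nonneg_right (norm_add_le _ _) hw
      rw [add_div] at h3
      show ‖f z + g z‖ / w ‖z‖ ≤ _
      linarith [le_abs_self A, le_abs_self B]
    · exact (div_nonpos_of_nonneg_of_nonpos (norm_nonneg _) hw).trans (by positivity)
  smul_mem' := by
    rintro c f ⟨hf, A, hA⟩
    refine ⟨hf.const_smul c, ‖c‖ * A, ?_⟩
    rintro _ ⟨z, rfl⟩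
    have h1 : ‖f z‖ / w ‖z‖ ≤ A := hA ⟨z, rfl⟩
    show ‖c • f z‖ / w ‖z‖ ≤ ‖c‖ * A
    rw [norm_smul, mul_div_assoc]
    exact mul_le_mul_of_nonneg_left h1 (norm_nonneg c)

/-- The Fock-Sobolev type growth space `F^∞_{1,β}(ℂ^d)`, with weight `(1+t)^β e^{t²/2}`. -/
noncomputable def fockSobolevInfty (d : ℕ) (β : ℝ) : Submodule ℂ (Cd d → ℂ) :=
  growthSpace d fun t => (1 + t) ^ β * Real.exp (t ^ 2 / 2)

/-- The growth Fock space `F^∞_α(ℂ^d)`, with weight `e^{α t²/2}`; that is, the entire functions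
with `sup_z |f z| e^{-α |z|²/2}` finite. -/
noncomputable def fockInfty (d : ℕ) (α : ℝ) : Submodule ℂ (Cd d → ℂ) :=
  growthSpace d fun t => Real.exp (α / 2 * t ^ 2)

/-- A positive Borel measure `μ` on `ℂ^d` is `q`-Carleson for a linear space `X` of (entire)
functions if `X ⊆ L^q(ℂ^d, μ)`. -/
def IsCarleson {d : ℕ} (q : ℝ) (μ : Measure (Cd d)) (X : Submodule ℂ (Cd d → ℂ)) : Prop :=
  ∀ f ∈ X, MemLp f (ENNReal.ofReal q) μ

end FockCarleson

/-!
The growth space `F` of the weight `w(t) = (1 + t)^β e^{α t²/2}` contains *finitely many* functions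
whose largest modulus is comparable to `w(|z|)` at every point `z`
(`exists_finite_family_ge_weight`). Once this is known the corollary is immediate: if `F ⊆ L^q(μ)`,
then `w^q` is dominated by a finite sum of `μ`-integrable functions `|f|^q`, and conversely every
`f ∈ F` satisfies `|f|^q ≤ A w^q`.

The finite family consists of lattice sums of normalized reproducing kernels. For a node `a` the
function `g_a(z) = (1 + |a|)^β exp(α⟨a, z⟩ - α|a|²/2)` is entire and
`|g_a(z)| = (1 + |a|)^β e^{α|z|²/2} e^{-α|z - a|²/2}`. So, up to constants, `|g_a(z)|` is at least
`w(|z|)` when `|z - a| ≤ 1`, and it is at most `w(|z|) (1 + |z - a|)^{-p}` for any prescribed `p`.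
Fix a full-rank lattice `L ⊆ ℂ^d` and `p > rank L`, so that `∑ |l|^{-p}` converges over `L`.
For a dilation `M > 0` and a translation `t`, the sum of the `g_a` over the nodes `a = M l + t`
is entire (`differentiable_latticeSum`) and `O(w(|z|))` (`latticeSum_mem_growthSpace`). The terms
other than that of a node within distance `1` of `z` contribute at most a constant times
`M^{-p} w(|z|)`, so for `M` large the nearby node dominates (`latticeSum_ge`). With such an `M` fixed,
finitely many translations `t` suffice for every point to be within distance `1` of some node,
because the fundamental domain of `M L` is bounded.
-/

namespace FockCarleson

/-! ### The weight and the normalized kernels -/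

/-- The weight `(1 + t)^β e^{α t²/2}`; both growth spaces of the theorem are of this form. -/
noncomputable def weight (α β t : ℝ) : ℝ := (1 + t) ^ β * Real.exp (α / 2 * t ^ 2)

lemma weight_pos (α β : ℝ) {t : ℝ} (ht : 0 ≤ t) : 0 < weight α β t :=
  mul_pos (Real.rpow_pos_of_pos (by linarith) _) (Real.exp_pos _)

lemma continuous_weight_norm {d : ℕ} (α β : ℝ) : Continuous fun z : Cd d => weight α β ‖z‖ := by
  unfold weight
  refine Continuous.mul (Continuous.rpow_const (by fun_prop) fun z => Or.inl ?_) (by fun_prop)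
  positivity

/-- Powers of `1 + t` are slowly varying (Peetre's inequality). -/
lemma one_add_rpow_le {x y u : ℝ} (hx : 0 ≤ x) (hy : 0 ≤ y) (hu : 0 ≤ u) (hxy : x ≤ y + u)
    (hyx : y ≤ x + u) (β : ℝ) : (1 + x) ^ β ≤ (1 + y) ^ β * (1 + u) ^ |β| := by
  rcases le_total 0 β with hβ | hβ
  · rw [abs_of_nonneg hβ, ← Real.mul_rpow (by positivity) (by positivity)]
    exact Real.rpow_le_rpow (by positivity) (by nlinarith) hβ
  · rw [abs_of_nonpos hβ, Real.rpow_neg (by positivity), ← div_eq_mul_inv,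
      le_div_iff₀ (by positivity), ← Real.mul_rpow (by positivity) (by positivity)]
    exact Real.rpow_le_rpow_of_nonpos (by positivity) (by nlinarith) hβ

/-- Gaussian decay beats every power. -/
lemma exists_rpow_mul_gaussian_le {α : ℝ} (hα : 0 < α) (s : ℝ) :
    ∃ C > 0, ∀ t : ℝ, 0 ≤ t → (1 + t) ^ s * Real.exp (-(α / 2 * t ^ 2)) ≤ C := by
  obtain ⟨N, hN⟩ := exists_nat_ge s
  refine ⟨N.factorial * Real.exp (1 + 1 / (2 * α)), by positivity, fun t ht => ?_⟩
  have h1 : (1 + t) ^ s ≤ N.factorial * Real.exp (1 + t) := by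
    have h := Real.pow_div_factorial_le_exp (1 + t) (by positivity) N
    rw [div_le_iff₀ (by positivity)] at h
    calc (1 + t) ^ s ≤ (1 + t) ^ (N : ℝ) := Real.rpow_le_rpow_of_exponent_le (by linarith) hN
      _ = (1 + t) ^ N := Real.rpow_natCast _ _
      _ ≤ _ := by linarith
  have h2 : 1 + t + -(α / 2 * t ^ 2) ≤ 1 + 1 / (2 * α) := by
    have : 1 / (2 * α) - t + α / 2 * t ^ 2 = α / 2 * (t - 1 / α) ^ 2 := by
      field_simp
      ring
    have : 0 ≤ α / 2 * (t - 1 / α) ^ 2 := by positivity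
    linarith
  calc (1 + t) ^ s * Real.exp (-(α / 2 * t ^ 2))
      ≤ N.factorial * Real.exp (1 + t) * Real.exp (-(α / 2 * t ^ 2)) := by gcongr
    _ = N.factorial * Real.exp (1 + t + -(α / 2 * t ^ 2)) := by
        rw [mul_assoc, ← Real.exp_add]
    _ ≤ _ := by gcongr

variable {d : ℕ}

/-- The reproducing kernel of the Fock space at the node `a`, normalized so that its modulus is of
the size of the weight near `a`: `g_a(z) = (1 + |a|)^β exp(α⟨a, z⟩ - α|a|²/2)`. -/
noncomputable def kernel (α β : ℝ) (a z : Cd d) : ℂ :=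
  ((1 + ‖a‖) ^ β : ℝ) * Complex.exp (α * inner ℂ a z - (α / 2 * ‖a‖ ^ 2 : ℝ))

lemma norm_kernel (α β : ℝ) (a z : Cd d) :
    ‖kernel α β a z‖ = (1 + ‖a‖) ^ β *
      (Real.exp (α / 2 * ‖z‖ ^ 2) * Real.exp (-(α / 2 * ‖z - a‖ ^ 2))) := by
  rw [kernel, norm_mul, Complex.norm_exp, Complex.norm_real,
    Real.norm_of_nonneg (by positivity), ← Real.exp_add]
  congr 2
  rw [Complex.sub_re, Complex.re_ofReal_mul, Complex.ofReal_re, @norm_sub_sq ℂ, inner_re_symm]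
  simp only [RCLike.re_to_complex]
  ring

/-- The derivative of the kernel at `z` is `g_a(z)` times the functional `α⟨a, ·⟩`. -/
lemma hasFDerivAt_kernel (α β : ℝ) (a z : Cd d) :
    HasFDerivAt (kernel α β a) ((kernel α β a z * α) • innerSL ℂ a) z := by
  have h1 : HasFDerivAt (fun z : Cd d => (α : ℂ) * inner ℂ a z - (α / 2 * ‖a‖ ^ 2 : ℝ))
      ((α : ℂ) • innerSL ℂ a) z :=
    (((innerSL ℂ a).hasFDerivAt (x := z)).const_mul (α : ℂ)).sub_const _
  have h2 := h1.cexp.const_mul (((1 + ‖a‖) ^ β : ℝ) : ℂ)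
  rw [smul_smul, smul_smul] at h2
  exact h2

/-- Away from its node a kernel is smaller than the weight by any power of the distance; the extra
factor on the left absorbs the size of the derivative. -/
lemma exists_norm_kernel_le {α : ℝ} (hα : 0 < α) (β p : ℝ) : ∃ C > 0, ∀ a z : Cd d,
    ‖kernel α β a z‖ * (1 + ‖z - a‖) ≤ C * weight α β ‖z‖ * (1 + ‖z - a‖) ^ (-p) := by
  obtain ⟨C, hC, h⟩ := exists_rpow_mul_gaussian_le hα (|β| + 1 + p)
  refine ⟨C, hC, fun a z => ?_⟩
  set s := ‖z - a‖ with hs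
  have hs0 : 0 ≤ s := norm_nonneg _
  have h1 : (1 + ‖a‖) ^ β ≤ (1 + ‖z‖) ^ β * (1 + s) ^ |β| := by
    refine one_add_rpow_le (norm_nonneg _) (norm_nonneg _) hs0 ?_ ?_ β
    · have := norm_sub_le z (z - a)
      rwa [sub_sub_cancel] at this
    · have := norm_add_le a (z - a)
      rwa [add_sub_cancel] at this
  have h2 := h s hs0
  rw [Real.rpow_add (by positivity), Real.rpow_add (by positivity), Real.rpow_one] at h2
  have h3 : (1 + s) ^ p * (1 + s) ^ (-p) = 1 := by
    rw [← Real.rpow_add (by positivity), add_neg_cancel, Real.rpow_zero]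
  rw [norm_kernel, ← hs, weight]
  set G := Real.exp (-(α / 2 * s ^ 2))
  set E := Real.exp (α / 2 * ‖z‖ ^ 2)
  calc (1 + ‖a‖) ^ β * (E * G) * (1 + s)
      ≤ (1 + ‖z‖) ^ β * (1 + s) ^ |β| * (E * G) * (1 + s) := by gcongr
    _ = (1 + ‖z‖) ^ β * E * ((1 + s) ^ |β| * (1 + s) * G) * ((1 + s) ^ p * (1 + s) ^ (-p)) := by
        rw [h3]; ring
    _ = (1 + ‖z‖) ^ β * E * ((1 + s) ^ |β| * (1 + s) * (1 + s) ^ p * G) * (1 + s) ^ (-p) := by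
        ring
    _ ≤ (1 + ‖z‖) ^ β * E * C * (1 + s) ^ (-p) := by gcongr
    _ = _ := by ring

lemma norm_kernel_ge {α : ℝ} (hα : 0 < α) (β : ℝ) {a z : Cd d} (h : ‖z - a‖ ≤ 1) :
    2 ^ (-|β|) * Real.exp (-(α / 2)) * weight α β ‖z‖ ≤ ‖kernel α β a z‖ := by
  have h1 : (1 + ‖z‖) ^ β ≤ (1 + ‖a‖) ^ β * (1 + 1) ^ |β| := by
    refine one_add_rpow_le (norm_nonneg _) (norm_nonneg _) zero_le_one ?_ ?_ β
    · have := norm_add_le a (z - a)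
      rw [add_sub_cancel] at this
      linarith
    · have := norm_sub_le z (z - a)
      rw [sub_sub_cancel] at this
      linarith
  have h2 : 2 ^ (-|β|) * (1 + ‖z‖) ^ β ≤ (1 + ‖a‖) ^ β := by
    rw [Real.rpow_neg zero_le_two, inv_mul_le_iff₀ (by positivity)]
    norm_num at h1
    linarith
  have h3 : Real.exp (-(α / 2)) ≤ Real.exp (-(α / 2 * ‖z - a‖ ^ 2)) := by
    have : ‖z - a‖ ^ 2 ≤ 1 := pow_le_one₀ (norm_nonneg _) h
    refine Real.exp_le_exp.mpr (neg_le_neg ?_)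
    nlinarith
  rw [norm_kernel, weight]
  calc _ = 2 ^ (-|β|) * (1 + ‖z‖) ^ β * (Real.exp (α / 2 * ‖z‖ ^ 2) * Real.exp (-(α / 2))) := by
        ring
    _ ≤ _ := by gcongr

/-! ### Lattice sums of kernels -/

/-- The node `M l + t` of the lattice `L`, dilated by `M` and translated by `t`. -/
noncomputable def node {L : Submodule ℤ (Cd d)} (M : ℝ) (t : Cd d) (l : L) : Cd d :=
  M • (l : Cd d) + t

/-- The sum of the kernels over the nodes `M l + t`, `l ∈ L`. -/
noncomputable def latticeSum (L : Submodule ℤ (Cd d)) (α β M : ℝ) (t z : Cd d) : ℂ :=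
  ∑' l : L, kernel α β (node M t l) z

variable {L : Submodule ℤ (Cd d)}

/-- If `z` is within `D` of the node of `l₀`, its distance to the node of `l` is comparable to
`M ‖l - l₀‖` from below. For `l = l₀` the right-hand side is `1`, since `0 ^ (-p) = 0`. -/
lemma one_add_norm_sub_node_rpow_le {p M D : ℝ} (hp : 0 < p) (hM : 0 < M) (hD : 0 ≤ D)
    {t z : Cd d} {l₀ : L} (h : ‖z - node M t l₀‖ ≤ D) (l : L) :
    (1 + ‖z - node M t l‖) ^ (-p) ≤
      (if l = l₀ then 1 else 0) + (1 + D) ^ p * M ^ (-p) * ‖l - l₀‖ ^ (-p) := by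
  split_ifs with hl
  · have : (1 + ‖z - node M t l‖) ^ (-p) ≤ 1 :=
      Real.rpow_le_one_of_one_le_of_nonpos (by linarith [norm_nonneg (z - node M t l)])
        (by linarith)
    have : 0 ≤ (1 + D) ^ p * M ^ (-p) * ‖l - l₀‖ ^ (-p) := by positivity
    linarith
  · have hpos : 0 < ‖l - l₀‖ := norm_pos_iff.mpr (sub_ne_zero.mpr hl)
    have h1 : M * ‖l - l₀‖ ≤ ‖z - node M t l‖ + D := by
      have h2 : M • ((l - l₀ : L) : Cd d) = (z - node M t l₀) - (z - node M t l) := by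
        simp only [node, Submodule.coe_sub, smul_sub]
        abel
      have h3 : M * ‖l - l₀‖ = ‖M • ((l - l₀ : L) : Cd d)‖ := by
        rw [norm_smul, Real.norm_of_nonneg hM.le, Submodule.coe_norm]
      rw [h3, h2]
      exact (norm_sub_le _ _).trans (by linarith)
    have h2 : M * ‖l - l₀‖ ≤ (1 + D) * (1 + ‖z - node M t l‖) := by
      nlinarith [norm_nonneg (z - node M t l)]
    have h3 := Real.rpow_le_rpow_of_nonpos (by positivity) h2 (neg_nonpos.mpr hp.le)
    rw [Real.mul_rpow (by positivity) (by positivity),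
      Real.mul_rpow (by positivity) (by positivity), Real.rpow_neg (by positivity : 0 ≤ 1 + D),
      inv_mul_le_iff₀ (by positivity)] at h3
    linarith

lemma hasSum_majorant {p : ℝ} (hS : Summable fun l : L => ‖l‖ ^ (-p)) (A : ℝ) (l₀ : L) :
    HasSum (fun l : L => (if l = l₀ then 1 else 0) + A * ‖l - l₀‖ ^ (-p))
      (1 + A * ∑' l : L, ‖l‖ ^ (-p)) :=
  (hasSum_ite_eq l₀ 1).add (((Equiv.subRight l₀).hasSum_iff.mpr hS.hasSum).mul_left A)

/-- With a kernel decay exponent `p` for which the lattice sum converges, the kernels at the nodes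
are dominated by a summable family, uniformly in the position of `z` relative to its node. -/
lemma norm_kernel_node_le {α β p C M D : ℝ} (hp : 0 < p) (hC : 0 < C) (hM : 0 < M) (hD : 0 ≤ D)
    (hK : ∀ a z : Cd d,
      ‖kernel α β a z‖ * (1 + ‖z - a‖) ≤ C * weight α β ‖z‖ * (1 + ‖z - a‖) ^ (-p))
    {t z : Cd d} {l₀ : L} (h : ‖z - node M t l₀‖ ≤ D) (l : L) :
    ‖kernel α β (node M t l) z‖ * (1 + ‖z - node M t l‖) ≤ C * weight α β ‖z‖ *
      ((if l = l₀ then 1 else 0) + (1 + D) ^ p * M ^ (-p) * ‖l - l₀‖ ^ (-p)) :=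
  (hK _ _).trans <| mul_le_mul_of_nonneg_left (one_add_norm_sub_node_rpow_le hp hM hD h l)
    (mul_pos hC (weight_pos _ _ (norm_nonneg z))).le

lemma norm_kernel_le_mul_one_add (α β : ℝ) (a z : Cd d) :
    ‖kernel α β a z‖ ≤ ‖kernel α β a z‖ * (1 + ‖z - a‖) :=
  le_mul_of_one_le_right (norm_nonneg _) (by linarith [norm_nonneg (z - a)])

lemma summable_kernel_node {α p M : ℝ} (hα : 0 < α) (β : ℝ) (hp : 0 < p) (hM : 0 < M)
    (hS : Summable fun l : L => ‖l‖ ^ (-p)) (t z : Cd d) :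
    Summable fun l : L => kernel α β (node M t l) z := by
  obtain ⟨C, hC, hK⟩ := exists_norm_kernel_le (d := d) hα β p
  exact Summable.of_norm_bounded ((hasSum_majorant hS _ 0).summable.mul_left _) fun l =>
    (norm_kernel_le_mul_one_add _ _ _ _).trans
      (norm_kernel_node_le hp hC hM (norm_nonneg _) hK (l₀ := 0) le_rfl l)

lemma differentiable_latticeSum {α p M : ℝ} (hα : 0 < α) (β : ℝ) (hp : 0 < p) (hM : 0 < M)
    (hS : Summable fun l : L => ‖l‖ ^ (-p)) (t : Cd d) :
    Differentiable ℂ (latticeSum L α β M t) := by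
  obtain ⟨C, hC, hK⟩ := exists_norm_kernel_le (d := d) hα β p
  intro z₀
  set R := ‖z₀‖ + 1 with hR
  have hR0 : 0 < R := by positivity
  obtain ⟨W, hW⟩ : ∃ W, ∀ z ∈ Metric.closedBall (0 : Cd d) R, weight α β ‖z‖ ≤ W := by
    obtain ⟨W, hW⟩ := (isCompact_closedBall (0 : Cd d) R).bddAbove_image
      (continuous_weight_norm α β).continuousOn
    exact ⟨W, fun z hz => hW ⟨z, hz, rfl⟩⟩
  set D := R + ‖node M t (0 : L)‖ with hD
  have hsum := (((hasSum_majorant hS ((1 + D) ^ p * M ^ (-p)) 0).summable).mul_left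
    (C * W)).mul_left (α * (1 + R))
  refine (hasFDerivAt_tsum_of_isPreconnected (𝕜 := ℂ) (s := Metric.ball (0 : Cd d) R)
    (f := fun (l : L) z => kernel α β (node M t l) z)
    (f' := fun (l : L) z => (kernel α β (node M t l) z * α) • innerSL ℂ (node M t l))
    (x₀ := 0) hsum Metric.isOpen_ball
    (convex_ball (0 : Cd d) R).isPreconnected
    (fun l z _ => hasFDerivAt_kernel α β _ z) (fun l z hz => ?_) (by simpa using hR0)
    (summable_kernel_node hα β hp hM hS t 0) (by simp [hR])).differentiableAt
  have hzR : ‖z‖ ≤ R := by simpa using (Metric.mem_ball.mp hz).le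
  have h1 : ‖z - node M t (0 : L)‖ ≤ D := (norm_sub_le _ _).trans (by linarith)
  have h2 := norm_kernel_node_le hp hC hM (by positivity : 0 ≤ D) hK h1 l
  have h3 : ‖node M t l‖ ≤ (1 + R) * (1 + ‖z - node M t l‖) := by
    have := norm_sub_le z (z - node M t l)
    rw [sub_sub_cancel] at this
    nlinarith [norm_nonneg (z - node M t l)]
  rw [norm_smul, norm_mul, innerSL_apply_norm, Complex.norm_real, Real.norm_of_nonneg hα.le]
  calc ‖kernel α β (node M t l) z‖ * α * ‖node M t l‖
      ≤ ‖kernel α β (node M t l) z‖ * α * ((1 + R) * (1 + ‖z - node M t l‖)) := by gcongr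
    _ = α * (1 + R) * (‖kernel α β (node M t l) z‖ * (1 + ‖z - node M t l‖)) := by ring
    _ ≤ α * (1 + R) * (C * weight α β ‖z‖ *
          ((if l = 0 then 1 else 0) + (1 + D) ^ p * M ^ (-p) * ‖l - 0‖ ^ (-p))) := by gcongr
    _ ≤ _ := by
        have h0 : 0 ≤ (if l = 0 then (1 : ℝ) else 0) := by split_ifs <;> norm_num
        gcongr
        exact hW z (Metric.ball_subset_closedBall hz)

/-- If the nodes form a net of some finite width, the lattice sum belongs to the growth space. -/
lemma latticeSum_mem_growthSpace {α p M D : ℝ} (hα : 0 < α) (β : ℝ) (hp : 0 < p) (hM : 0 < M)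
    (hS : Summable fun l : L => ‖l‖ ^ (-p)) (t : Cd d) (hD : 0 ≤ D)
    (hnet : ∀ z : Cd d, ∃ l : L, ‖z - node M t l‖ ≤ D) :
    latticeSum L α β M t ∈ growthSpace d (weight α β) := by
  obtain ⟨C, hC, hK⟩ := exists_norm_kernel_le (d := d) hα β p
  refine ⟨differentiable_latticeSum hα β hp hM hS t,
    C * (1 + (1 + D) ^ p * M ^ (-p) * ∑' l : L, ‖l‖ ^ (-p)), ?_⟩
  rintro _ ⟨z, rfl⟩
  obtain ⟨l₀, hl₀⟩ := hnet z
  have := tsum_of_norm_bounded ((hasSum_majorant hS ((1 + D) ^ p * M ^ (-p)) l₀).mul_left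
    (C * weight α β ‖z‖)) fun l => (norm_kernel_le_mul_one_add _ _ _ _).trans
      (norm_kernel_node_le hp hC hM hD hK hl₀ l)
  simp only [div_le_iff₀ (weight_pos α β (norm_nonneg z))]
  refine this.trans (le_of_eq ?_)
  ring

/-- For a sufficiently sparse lattice, a node within distance `1` dominates the lattice sum. The
threshold for the dilation does not depend on the translation. -/
lemma latticeSum_ge {α p : ℝ} (hα : 0 < α) (β : ℝ) (hp : 0 < p)
    (hS : Summable fun l : L => ‖l‖ ^ (-p)) :
    ∃ κ > 0, ∃ M > 0, ∀ (t z : Cd d) (l₀ : L), ‖z - node M t l₀‖ ≤ 1 →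
      κ * weight α β ‖z‖ ≤ ‖latticeSum L α β M t z‖ := by
  obtain ⟨C, hC, hK⟩ := exists_norm_kernel_le (d := d) hα β p
  set S := ∑' l : L, ‖l‖ ^ (-p)
  set κ : ℝ := 2 ^ (-|β|) * Real.exp (-(α / 2)) with hκ
  have hκ0 : 0 < κ := by positivity
  obtain ⟨M, hMκ, hM⟩ : ∃ M : ℝ, C * ((1 + 1) ^ p * M ^ (-p) * S) < κ / 2 ∧ 0 < M := by
    have h : Filter.Tendsto (fun M : ℝ => C * ((1 + 1) ^ p * M ^ (-p) * S)) Filter.atTop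
        (nhds (C * ((1 + 1) ^ p * 0 * S))) :=
      (((tendsto_rpow_neg_atTop hp).const_mul _).mul_const _).const_mul _
    refine ((h.eventually_lt_const (u := κ / 2) ?_).and (Filter.eventually_gt_atTop 0)).exists
    simpa using hκ0
  refine ⟨κ / 2, by positivity, M, hM, fun t z l₀ hl₀ => ?_⟩
  have hw := weight_pos α β (norm_nonneg z)
  have hsplit : latticeSum L α β M t z = kernel α β (node M t l₀) z +
      ∑' l : L, if l = l₀ then 0 else kernel α β (node M t l) z :=
    (summable_kernel_node hα β hp hM hS t z).tsum_eq_add_tsum_ite l₀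
  have hrest : ‖∑' l : L, if l = l₀ then 0 else kernel α β (node M t l) z‖ ≤
      C * weight α β ‖z‖ * ((1 + 1) ^ p * M ^ (-p) * S) := by
    refine tsum_of_norm_bounded (((((Equiv.subRight l₀).hasSum_iff.mpr hS.hasSum).mul_left
      ((1 + 1) ^ p * M ^ (-p)))).mul_left (C * weight α β ‖z‖)) fun l => ?_
    split_ifs with h
    · rw [norm_zero]
      simp only [Function.comp_apply]
      positivity
    · have := norm_kernel_node_le hp hC hM zero_le_one hK hl₀ l
      rw [if_neg h, zero_add] at this
      exact (norm_kernel_le_mul_one_add _ _ _ _).trans this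
  have hmain := norm_kernel_ge hα β hl₀
  rw [← hκ] at hmain
  have h1 : ‖kernel α β (node M t l₀) z‖ ≤ ‖latticeSum L α β M t z‖ +
      ‖∑' l : L, if l = l₀ then 0 else kernel α β (node M t l) z‖ := by
    rw [hsplit]
    exact norm_le_add_norm_add _ _
  have h2 : C * weight α β ‖z‖ * ((1 + 1) ^ p * M ^ (-p) * S) ≤ κ / 2 * weight α β ‖z‖ := by
    nlinarith
  have h3 := h1.trans (add_le_add_right (hrest.trans h2) _)
  linarith

/-- Finitely many functions of the growth space whose largest modulus is comparable to the
weight at every point. -/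
theorem exists_finite_family_ge_weight (d : ℕ) {α : ℝ} (hα : 0 < α) (β : ℝ) :
    ∃ (T : Finset (Cd d)) (F : Cd d → Cd d → ℂ), ∃ κ > 0,
      (∀ t ∈ T, F t ∈ growthSpace d (weight α β)) ∧
      ∀ z, ∃ t ∈ T, κ * weight α β ‖z‖ ≤ ‖F t z‖ := by
  let b := Module.finBasis ℝ (Cd d)
  let L : Submodule ℤ (Cd d) := Submodule.span ℤ (Set.range b)
  obtain ⟨p, hp, hpL⟩ : ∃ p : ℝ, 0 < p ∧ -p < -(Module.finrank ℤ L : ℝ) :=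
    ⟨Module.finrank ℤ L + 1, by positivity, by linarith⟩
  have hS : Summable fun l : L => ‖l‖ ^ (-p) := ZLattice.summable_norm_rpow L (-p) hpL
  obtain ⟨κ, hκ, M, hM, hge⟩ := latticeSum_ge (L := L) hα β hp hS
  set B := M * ∑ i, ‖b i‖ with hB
  have hB0 : 0 ≤ B := by positivity
  -- Rounding the coordinates of `z / M` gives a point of `M L` within `B` of `z`.
  have hfloor : ∀ z : Cd d, ∃ l : L, ‖z - M • (l : Cd d)‖ ≤ B := fun z => by
    refine ⟨ZSpan.floor b (M⁻¹ • z), ?_⟩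
    have h1 : z - M • (ZSpan.floor b (M⁻¹ • z) : Cd d) = M • ZSpan.fract b (M⁻¹ • z) := by
      rw [ZSpan.fract_apply, smul_sub, smul_inv_smul₀ hM.ne']
    rw [h1, norm_smul, Real.norm_of_nonneg hM.le]
    exact mul_le_mul_of_nonneg_left (ZSpan.norm_fract_le b _) hM.le
  obtain ⟨T, -, hTfin, hT⟩ := (isCompact_closedBall (0 : Cd d) B).finite_cover_balls zero_lt_one
  refine ⟨hTfin.toFinset, latticeSum L α β M, κ, hκ, fun t _ => ?_, fun z => ?_⟩
  · refine latticeSum_mem_growthSpace hα β hp hM hS t hB0 fun z => ?_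
    obtain ⟨l, hl⟩ := hfloor (z - t)
    exact ⟨l, by rwa [node, ← sub_sub, sub_right_comm]⟩
  · obtain ⟨l, hl⟩ := hfloor z
    have : z - M • (l : Cd d) ∈ Metric.closedBall (0 : Cd d) B := by simpa using hl
    obtain ⟨t, ht, hzt⟩ := Set.mem_iUnion₂.mp (hT this)
    refine ⟨t, hTfin.mem_toFinset.mpr ht, hge t z l ?_⟩
    rw [Metric.mem_ball, dist_eq_norm, sub_sub] at hzt
    exact hzt.le

/-! ### Carleson measures -/

/-- The Carleson measures of a growth space are those that integrate the `q`-th power of the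
weight. -/
theorem isCarleson_growthSpace_iff {q α : ℝ} (hq : 0 < q) (hα : 0 < α) (β : ℝ)
    (μ : Measure (Cd d)) :
    IsCarleson q μ (growthSpace d (weight α β)) ↔
      ∫⁻ z, ENNReal.ofReal (weight α β ‖z‖ ^ q) ∂μ < ⊤ := by
  have hq0 : ENNReal.ofReal q ≠ 0 := by simpa using hq
  have henorm : ∀ x : ℂ, ‖x‖ₑ ^ q = ENNReal.ofReal (‖x‖ ^ q) := fun x => by
    rw [← ofReal_norm, ENNReal.ofReal_rpow_of_nonneg (norm_nonneg _) hq.le]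
  have hLp : ∀ f : Cd d → ℂ, eLpNorm f (ENNReal.ofReal q) μ < ⊤ ↔
      ∫⁻ z, ENNReal.ofReal (‖f z‖ ^ q) ∂μ < ⊤ := fun f => by
    rw [eLpNorm_lt_top_iff_lintegral_rpow_enorm_lt_top hq0 ENNReal.ofReal_ne_top,
      ENNReal.toReal_ofReal hq.le]
    simp_rw [henorm]
  constructor
  · intro h
    obtain ⟨T, F, κ, hκ, hF, hge⟩ := exists_finite_family_ge_weight d hα β
    have hmeas : ∀ t ∈ T, Measurable fun z => ENNReal.ofReal (‖F t z‖ ^ q) := fun t ht =>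
      ((hF t ht).1.continuous.norm.measurable.pow_const q).ennreal_ofReal
    calc ∫⁻ z, ENNReal.ofReal (weight α β ‖z‖ ^ q) ∂μ
        ≤ ∫⁻ z, ENNReal.ofReal (κ⁻¹ ^ q) * ∑ t ∈ T, ENNReal.ofReal (‖F t z‖ ^ q) ∂μ := by
          refine lintegral_mono fun z => ?_
          obtain ⟨t, ht, hz⟩ := hge z
          have hw := (weight_pos α β (norm_nonneg z)).le
          refine le_trans ?_ (mul_le_mul_right (Finset.single_le_sum_of_canonicallyOrdered
            (f := fun t => ENNReal.ofReal (‖F t z‖ ^ q)) ht) _)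
          rw [← ENNReal.ofReal_mul (by positivity),
            ← Real.mul_rpow (by positivity) (norm_nonneg _)]
          refine ENNReal.ofReal_le_ofReal (Real.rpow_le_rpow hw ?_ hq.le)
          rwa [le_inv_mul_iff₀ hκ]
      _ = ENNReal.ofReal (κ⁻¹ ^ q) * ∑ t ∈ T, ∫⁻ z, ENNReal.ofReal (‖F t z‖ ^ q) ∂μ := by
          rw [lintegral_const_mul' _ _ ENNReal.ofReal_ne_top, lintegral_finsetSum' _
            fun t ht => (hmeas t ht).aemeasurable]
      _ < ⊤ := ENNReal.mul_lt_top ENNReal.ofReal_lt_top <| ENNReal.sum_lt_top.mpr fun t ht =>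
          (hLp _).mp (h _ (hF t ht)).2
  · rintro h f ⟨hf, A, hA⟩
    refine ⟨hf.continuous.aestronglyMeasurable, (hLp f).mpr ?_⟩
    calc ∫⁻ z, ENNReal.ofReal (‖f z‖ ^ q) ∂μ
        ≤ ∫⁻ z, ENNReal.ofReal (|A| ^ q) * ENNReal.ofReal (weight α β ‖z‖ ^ q) ∂μ := by
          refine lintegral_mono fun z => ?_
          have hw := weight_pos α β (norm_nonneg z)
          have hz : ‖f z‖ / weight α β ‖z‖ ≤ |A| := (hA ⟨z, rfl⟩).trans (le_abs_self A)
          rw [div_le_iff₀ hw] at hz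
          rw [← ENNReal.ofReal_mul (by positivity), ← Real.mul_rpow (abs_nonneg _) hw.le]
          exact ENNReal.ofReal_le_ofReal (Real.rpow_le_rpow (norm_nonneg _) hz hq.le)
      _ = ENNReal.ofReal (|A| ^ q) * ∫⁻ z, ENNReal.ofReal (weight α β ‖z‖ ^ q) ∂μ :=
          lintegral_const_mul' _ _ ENNReal.ofReal_ne_top
      _ < ⊤ := ENNReal.mul_lt_top ENNReal.ofReal_lt_top h

lemma weight_rpow (α β q : ℝ) {t : ℝ} (ht : 0 ≤ t) :
    weight α β t ^ q = ((1 + t) ^ β) ^ q * Real.exp (α * q / 2 * t ^ 2) := by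
  rw [weight, Real.mul_rpow (by positivity) (Real.exp_pos _).le, ← Real.exp_mul]
  ring_nf

end FockCarleson

theorem corollary3p2 (d : ℕ) (hd : 1 ≤ d) (q : ℝ) (hq : 0 < q)
    (μ : MeasureTheory.Measure (FockCarleson.Cd d)) :
    (∀ β : ℝ, FockCarleson.IsCarleson q μ (FockCarleson.fockSobolevInfty d β) ↔
      ∫⁻ z, ENNReal.ofReal (((1 + ‖z‖) ^ β) ^ q * Real.exp (q / 2 * ‖z‖ ^ 2)) ∂μ < ⊤) ∧
    (∀ α : ℝ, 0 < α → (FockCarleson.IsCarleson q μ (FockCarleson.fockInfty d α) ↔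
      ∫⁻ z, ENNReal.ofReal (Real.exp (α * q / 2 * ‖z‖ ^ 2)) ∂μ < ⊤)) := by
  refine ⟨fun β => ?_, fun α hα => ?_⟩
  · have h : FockCarleson.fockSobolevInfty d β =
        FockCarleson.growthSpace d (FockCarleson.weight 1 β) := by
      unfold FockCarleson.fockSobolevInfty FockCarleson.weight
      congr 1
      ext t
      ring_nf
    rw [h, FockCarleson.isCarleson_growthSpace_iff hq one_pos]
    simp only [FockCarleson.weight_rpow 1 β q (norm_nonneg _), one_mul]
  · have h : FockCarleson.fockInfty d α =
        FockCarleson.growthSpace d (FockCarleson.weight α 0) := by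
      unfold FockCarleson.fockInfty FockCarleson.weight
      simp only [Real.rpow_zero, one_mul]
    rw [h, FockCarleson.isCarleson_growthSpace_iff hq hα]
    simp only [FockCarleson.weight_rpow α 0 q (norm_nonneg _), Real.rpow_zero, Real.one_rpow,
      one_mul]
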